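/- Let $k$ be a field, let $n\ge 0$, and let $H\subseteq\mathbb{Z}^n$ be a subsemigroup containing $0$ which is positive (if $h\in H$ and $-h\in H$, then $h=0$) and normal (whenever $h,h'\in H$ and $m(h-h')\in H$ for some positive integer $m$, then $h-h'\in H$); $H$ is not assumed to be finitely generated. Let $k[H]=\bigoplus_{h\in H}kX^h$ be its semigroup ring, with multiplication $X^hX^{h'}=X^{h+h'}$. Then there is a direct system $\{A_i : i\in\mathbb{N}\}$ of $k$-algebras and $k$-algebra homomorphisms with the following properties: (i) each $A_i$ is a Noetherian polynomial ring over $k$, i.e. a polynomial ring over $k$ in finitely many variables; (ii) the transition map $A_i\to A_j$ is toric for all $i\le j$, i.e. it sends each monomial (product of powers of the variables, with coefficient $1$) to such a monomial; (iii) $k[H]$ is a direct summand of $A:=\varinjlim_{i\in\mathbb{N}}A_i$, i.e. there are an injective $k$-algebra homomorphism $\iota:k[H]\to A$ and a $k[H]$-submodule $M$ of $A$ such that $A=\iota(k[H])\oplus M$ as $k[H]$-modules. -/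

import Mathlib

/-- A subsemigroup (with `0`) `C` of an abelian group is *positive* if it has no invertible element
other than the trivial one `0`. -/
def AddSubmonoid.IsPositive {G : Type*} [AddCommGroup G] (C : AddSubmonoid G) : Prop :=
  ∀ c ∈ C, -c ∈ C → c = 0

/-- A subsemigroup `C` of an abelian group is *normal* if, whenever `c, c' ∈ C` and
`m (c - c') ∈ C` for some positive integer `m`, then `c - c' ∈ C`. -/
def AddSubmonoid.IsNormalSemigroup {G : Type*} [AddCommGroup G] (C : AddSubmonoid G) : Prop :=
  ∀ c ∈ C, ∀ c' ∈ C, ∀ m : ℕ, 0 < m → m • (c - c') ∈ C → c - c' ∈ C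

/-- A `k`-algebra homomorphism between polynomial rings over `k` is *toric* if it sends every
monomial `X ^ a` to a monomial `X ^ b`. -/
def MvPolynomial.IsToric {k σ τ : Type*} [CommRing k]
    (φ : MvPolynomial σ k →ₐ[k] MvPolynomial τ k) : Prop :=
  ∀ a : σ →₀ ℕ, ∃ b : τ →₀ ℕ, φ (MvPolynomial.monomial a 1) = MvPolynomial.monomial b 1

/-- A ring homomorphism `ι : R → A` makes `R` a *direct summand* of `A` if it is injective and its
image has a complement in `A` as an `R`-module, i.e. `A = ι(R) ⊕ M` for an `R`-submodule `M`. -/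
def RingHom.IsDirectSummand {R A : Type*} [CommRing R] [CommRing A] (ι : R →+* A) : Prop :=
  letI : Algebra R A := ι.toAlgebra
  Function.Injective ι ∧ ∃ M : Submodule R A, IsCompl (LinearMap.range (Algebra.linearMap R A)) M

/-!
The semigroup `H` is the increasing union of the monoids `H i` generated by its first `i` elements in
some enumeration. Dually, the functionals `ℤ ^ n → ℤ` that are nonnegative on `H i` form a decreasing
chain of monoids, each finitely generated by Gordan's lemma (`AddSubmonoid.fg_comap_nonneg`). With
generators `u i 1, …, u i (s i)`, evaluation is a map `H i → ℕ ^ (s i)`. Since the generators at level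
`i + 1` are natural combinations of those at level `i`, the coefficients give maps
`ℕ ^ (s i) → ℕ ^ (s (i + 1))` compatible with evaluation (`IsCoord.exists_transition`), and `H` maps
to the limit `D` of the free monoids `ℕ ^ (s i)`.

Suppose that a difference `x - y` of elements of `H` is represented in `D`. Then it is nonnegative
under the whole dual of some `H i`, so a positive multiple of it lies in `H i` by Farkas' lemma
(`exists_nsmul_mem_closure`), and `x - y` lies in `H` by normality. Together with positivity this
makes `H → D` injective, and `d ∈ D` lies in `H` as soon as `h + d ∈ H` for some `h ∈ H`
(`exists_pure_directLimit`). The elements of `D` outside `H` are therefore stable under translation by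
`H`, and discarding the corresponding monomials is a `k[H]`-linear retraction onto `k[H]` of
`k[D]`, and hence of the limit of the polynomial rings `k[ℕ ^ (s i)]`
(`AddMonoidAlgebra.exists_isDirectSummand_directLimit`). The transition maps are induced by maps of
exponents, so they are toric.
-/

/-! ### Farkas' lemma and Gordan's lemma over the integers -/

/-- Farkas' lemma over `ℤ`: a point none of whose positive multiples lies in a finitely generated
submonoid is separated from it by an integral functional. The generators are taken in the form
`P s`, with `P` varying, so that the induction can project along the last generator. -/
theorem AddMonoidHom.exists_nsmul_mem_closure_or_exists_neg {G : Type*} [AddCommGroup G]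
    (hsep : ∀ x : G, x ≠ 0 → ∃ f : G →+ ℤ, f x < 0) (S : Finset G) (P : G →+ G) (x : G) :
    (∃ m : ℕ, 0 < m ∧ m • x ∈ AddSubmonoid.closure (P '' S)) ∨
      ∃ f : G →+ ℤ, (∀ s ∈ S, 0 ≤ f (P s)) ∧ f x < 0 := by
  classical
  induction S using Finset.induction_on generalizing P x with
  | empty =>
    rcases eq_or_ne x 0 with rfl | hx
    · exact .inl ⟨1, one_pos, by simp⟩
    · obtain ⟨f, hf⟩ := hsep x hx
      exact .inr ⟨f, by simp, hf⟩
  | insert a S _ ih =>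
    have hle : AddSubmonoid.closure (P '' S) ≤ AddSubmonoid.closure (P '' (insert a S : Finset G)) :=
      AddSubmonoid.closure_mono (Set.image_mono (by simp))
    rcases ih P x with ⟨m, hm, hmem⟩ | ⟨f, hfS, hfx⟩
    · exact .inl ⟨m, hm, hle hmem⟩
    rcases le_or_gt 0 (f (P a)) with hfa | hfa
    · exact .inr ⟨f, by simpa [hfa] using hfS, hfx⟩
    -- `f` is negative at `P a` and at `x`. The map `Q` is, up to the positive factor `-f (P a)`, the
    -- projection onto `ker f` along `P a`; the alternative is decided for the images under `Q`.
    let Q : G →+ G := (-f (P a)) • AddMonoidHom.id G + (zmultiplesHom G (P a)).comp f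
    have hQ (v : G) : Q v = (-f (P a)) • v + f v • P a := by simp [Q]
    rcases ih (Q.comp P) (Q x) with ⟨m, hm, hmem⟩ | ⟨h, hhS, hhx⟩
    · left
      have himg : (Q.comp P) '' S = Q '' (P '' S) := by simp [Set.image_image]
      rw [himg, ← AddMonoidHom.map_mclosure] at hmem
      obtain ⟨c, hc, hcx⟩ := hmem
      have hfc : 0 ≤ f c := by
        have : AddSubmonoid.closure (P '' S) ≤ (AddSubmonoid.nonneg ℤ).comap f := by
          rw [AddSubmonoid.closure_le]
          rintro _ ⟨s, hs, rfl⟩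
          simpa using hfS s hs
        simpa using this hc
      obtain ⟨p, hp⟩ := Int.eq_ofNat_of_zero_le (neg_nonneg.2 hfa.le)
      obtain ⟨q, hq⟩ := Int.eq_ofNat_of_zero_le
        (show 0 ≤ f c - m * f x by nlinarith [Int.natCast_nonneg m])
      refine ⟨p * m, Nat.mul_pos (by omega) hm, ?_⟩
      -- Lifting `m • Q x = Q c` costs a multiple of `P a`, with coefficient `f c - m * f x ≥ 0`.
      have key : (p * m) • x = p • c + q • P a := by
        have h1 : m • Q x = Q c := hcx.symm
        rw [hQ, hQ, hp] at h1
        have h2 : (q : ℤ) • P a = (f c - m * f x) • P a := by rw [hq]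
        rw [← natCast_zsmul (P a) q, h2, sub_smul, mul_smul, mul_smul]
        simp only [natCast_zsmul, smul_add] at h1 ⊢
        rw [smul_comm p m x, ← add_sub_assoc, eq_sub_iff_add_eq]
        exact h1
      rw [key]
      exact add_mem (nsmul_mem (hle hc) _)
        (nsmul_mem (AddSubmonoid.subset_closure (Set.mem_image_of_mem P (by simp))) _)
    · refine .inr ⟨h.comp Q, ?_, hhx⟩
      simp only [Finset.mem_insert, forall_eq_or_imp]
      exact ⟨by simp [hQ], hhS⟩

/-- Gordan's lemma: the elements of a finitely generated monoid at which finitely many integral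
functionals are nonnegative form a finitely generated monoid. -/
theorem AddSubmonoid.fg_comap_nonneg {N ι : Type*} [AddCommMonoid N] [AddMonoid.FG N] [Finite ι]
    (g : N →+ (ι → ℤ)) : ((AddSubmonoid.nonneg (ι → ℤ)).comap g).FG := by
  obtain ⟨S, hS⟩ := (AddMonoid.FG.fg_top : (⊤ : AddSubmonoid N).FG)
  -- `p` presents `N` by the generators `S`, and `q` reads off slack variables for the inequalities;
  -- the submonoid is the image under `p` of the solutions of `g (p a) = q a` in natural numbers.
  let p : (S ⊕ ι → ℕ) →+ N :=
    { toFun a := ∑ s : S, a (.inl s) • (s : N)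
      map_zero' := by simp
      map_add' a b := by simp [add_smul, Finset.sum_add_distrib] }
  let q : (S ⊕ ι → ℕ) →+ (ι → ℤ) :=
    { toFun a i := a (.inr i)
      map_zero' := by ext; simp
      map_add' a b := by ext; simp }
  have := (AddSubmonoid.fg_eqLocusM (g.comp p) q).map p
  convert this
  ext x
  simp only [AddSubmonoid.mem_comap, AddSubmonoid.mem_nonneg, AddSubmonoid.mem_map]
  constructor
  · intro hx
    have hxS : x ∈ Submodule.span ℕ (Set.range ((↑) : S → N)) := by
      have : x ∈ AddSubmonoid.closure (S : Set N) := hS ▸ AddSubmonoid.mem_top x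
      simpa [← Submodule.span_nat_eq_addSubmonoidClosure] using this
    obtain ⟨c, rfl⟩ := (Submodule.mem_span_range_iff_exists_fun ℕ).1 hxS
    refine ⟨Sum.elim c fun i => (g (∑ s : S, c s • (s : N)) i).toNat, ?_, by simp [p]⟩
    ext i
    simpa [p, q] using (hx i)
  · rintro ⟨a, ha, rfl⟩ i
    have := congrFun ha i
    simp only [AddMonoidHom.comp_apply] at this
    rw [this]
    simp [q]

instance AddMonoidHom.fg_pi_int (n : ℕ) : AddMonoid.FG ((Fin n → ℤ) →+ ℤ) := by
  have : Module.Finite ℤ ((Fin n → ℤ) →+ ℤ) :=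
    Module.Finite.equiv (addMonoidHomLequivInt (A := Fin n → ℤ) (B := ℤ) ℤ).symm
  rw [← AddGroup.fg_iff_addMonoid_fg]
  exact Module.Finite.iff_addGroup_fg.1 this

/-- A lattice point at which every functional nonnegative on `S` is nonnegative has a positive
multiple in the monoid generated by `S`. -/
theorem exists_nsmul_mem_closure {n : ℕ} (S : Finset (Fin n → ℤ)) (x : Fin n → ℤ)
    (hx : ∀ f : (Fin n → ℤ) →+ ℤ, (∀ s ∈ S, 0 ≤ f s) → 0 ≤ f x) :
    ∃ m : ℕ, 0 < m ∧ m • x ∈ AddSubmonoid.closure (S : Set (Fin n → ℤ)) := by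
  have hsep (y : Fin n → ℤ) (hy : y ≠ 0) : ∃ f : (Fin n → ℤ) →+ ℤ, f y < 0 := by
    obtain ⟨l, hl⟩ := Function.ne_iff.1 hy
    rcases lt_or_gt_of_ne hl with h | h
    · exact ⟨Pi.evalAddMonoidHom _ l, h⟩
    · exact ⟨-Pi.evalAddMonoidHom _ l, by simpa using h⟩
  rcases AddMonoidHom.exists_nsmul_mem_closure_or_exists_neg hsep S (.id _) x with h | ⟨f, hf, hfx⟩
  · simpa using h
  · exact absurd hfx (hx f hf).not_gt

/-- The dual monoid of a set `S`: the integral functionals that are nonnegative on `S`. -/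
def dualMonoid {G : Type*} [AddCommGroup G] (S : Set G) : AddSubmonoid (G →+ ℤ) where
  carrier := {f | ∀ s ∈ S, 0 ≤ f s}
  zero_mem' _ _ := le_rfl
  add_mem' hf hg s hs := add_nonneg (hf s hs) (hg s hs)

theorem dualMonoid_anti {G : Type*} [AddCommGroup G] {S T : Set G} (h : S ⊆ T) :
    dualMonoid T ≤ dualMonoid S := fun _ hf s hs => hf s (h hs)

theorem exists_closure_range_eq_dualMonoid {n : ℕ} (S : Finset (Fin n → ℤ)) :
    ∃ (s : ℕ) (u : Fin s → (Fin n → ℤ) →+ ℤ),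
      AddSubmonoid.closure (Set.range u) = dualMonoid (S : Set (Fin n → ℤ)) := by
  let g : ((Fin n → ℤ) →+ ℤ) →+ (S → ℤ) :=
    { toFun f x := f x
      map_zero' := rfl
      map_add' _ _ := rfl }
  have hg : (AddSubmonoid.nonneg (S → ℤ)).comap g = dualMonoid (S : Set (Fin n → ℤ)) := by
    ext f
    simp [dualMonoid, g, Pi.le_def]
  obtain ⟨F, hF⟩ := hg ▸ AddSubmonoid.fg_comap_nonneg g
  refine ⟨F.card, fun l => (F.equivFin.symm l : (Fin n → ℤ) →+ ℤ), ?_⟩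
  rw [← hF]
  congr 1
  ext f
  constructor
  · rintro ⟨l, rfl⟩
    exact (F.equivFin.symm l).2
  · intro hf
    exact ⟨F.equivFin ⟨f, hf⟩, by simp⟩

/-! ### Direct summands and direct limits of monoid algebras -/

/-- The kernel of an `R`-linear retraction is a complement of `R`. -/
theorem RingHom.isDirectSummand_of_retraction {R A : Type*} [CommRing R] [CommRing A]
    (ι : R →+* A) (ρ : A →+ R) (hι : ∀ x, ρ (ι x) = x) (hρ : ∀ x a, ρ (ι x * a) = x * ρ a) :
    ι.IsDirectSummand := by
  let _ : Algebra R A := ι.toAlgebra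
  refine ⟨Function.LeftInverse.injective hι, ?_⟩
  let ρ' : A →ₗ[R] R := { ρ with map_smul' := fun x a => hρ x a }
  refine ⟨LinearMap.ker ρ', ?_, ?_⟩
  · rw [Submodule.disjoint_def]
    rintro _ ⟨x, rfl⟩ hx
    have : ρ (ι x) = 0 := hx
    rw [hι] at this
    simp [this]
  · rw [codisjoint_iff, Submodule.eq_top_iff']
    intro a
    refine Submodule.mem_sup.2 ⟨ι (ρ a), ⟨ρ a, rfl⟩, a - ι (ρ a), ?_, by simp⟩
    change ρ (a - ι (ρ a)) = 0
    rw [map_sub, hι, sub_self]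

namespace AddMonoidAlgebra

/-- If `f : H → D` is injective and `f h + d ∈ f(H)` forces `d ∈ f(H)`, then the exponents outside
`f(H)` are stable under translation by `f(H)`, so that discarding them is a `k[H]`-linear map
`k[D] → k[H]`. -/
theorem comapDomain_mapDomain_mul {k H D : Type*} [CommRing k] [AddCommMonoid H]
    [AddCommMonoid D] (f : H →+ D) (hf : Function.Injective f)
    (hpure : ∀ h h' d, f h + d = f h' → d ∈ Set.range f) (y : AddMonoidAlgebra k H)
    (x : AddMonoidAlgebra k D) :
    comapDomain f hf (mapDomain f y * x) = y * comapDomain f hf x := by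
  induction y using AddMonoidAlgebra.induction_linear with
  | zero => simp
  | add y z hy hz => simp [mapDomain_add, add_mul, comapDomain_add, hy, hz]
  | single h r =>
    induction x using AddMonoidAlgebra.induction_linear with
    | zero => simp
    | add y z hy hz => rw [mul_add, comapDomain_add, hy, hz, comapDomain_add, mul_add]
    | single d c =>
      rw [mapDomain_single, single_mul_single]
      by_cases hd : d ∈ Set.range f
      · obtain ⟨h', rfl⟩ := hd
        rw [← map_add, comapDomain_single_map, comapDomain_single_map, single_mul_single]
      · have hhd : f h + d ∉ Set.range f := fun ⟨h', hh'⟩ => hd (hpure h h' d hh'.symm)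
        have hzero {e : D} (he : e ∉ Set.range f) (c : k) : comapDomain f hf (single e c) = 0 := by
          ext; simp [he]
        rw [hzero hd, hzero hhd, mul_zero]

variable {k H : Type*} [CommRing k] [AddCommMonoid H] {M : ℕ → Type*} [∀ i, AddCommMonoid (M i)]
  (t : ∀ i j, i ≤ j → M i →+ M j)

theorem directedSystem_mapDomainAlgHom [DirectedSystem M (t · · ·)] :
    DirectedSystem (fun i => AddMonoidAlgebra k (M i))
      (fun i j h => mapDomainAlgHom k k (t i j h)) where
  map_self i x := by
    have : t i i le_rfl = .id _ := by ext x; exact DirectedSystem.map_self' t x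
    simp [this]
  map_map l j i hij hjl x := by
    have : t i l (hij.trans hjl) = (t j l hjl).comp (t i j hij) := by
      ext x; exact (DirectedSystem.map_map' t hij hjl x).symm
    rw [this, mapDomainAlgHom_comp]; rfl

/-- A pure embedding of `H` into a direct limit of monoids exhibits `k[H]` as a direct summand of the
direct limit of the monoid algebras. -/
theorem exists_isDirectSummand_directLimit [DirectedSystem M (t · · ·)]
    [DirectedSystem (fun i => AddMonoidAlgebra k (M i))
      (fun i j h => mapDomainAlgHom k k (t i j h))]
    (f : H →+ DirectLimit M t) (hf : Function.Injective f)
    (hpure : ∀ h h' d, f h + d = f h' → d ∈ Set.range f) :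
    ∃ ι : AddMonoidAlgebra k H →ₐ[k] DirectLimit (fun i => AddMonoidAlgebra k (M i))
        (fun i j h => mapDomainAlgHom k k (t i j h)),
      RingHom.IsDirectSummand (ι : AddMonoidAlgebra k H →+*
        DirectLimit (fun i => AddMonoidAlgebra k (M i))
          (fun i j h => mapDomainAlgHom k k (t i j h))) := by
  -- `Ψ d` is the monomial with exponent `d` in the direct limit of the monoid algebras.
  let Ψ : Multiplicative (DirectLimit M t) →* DirectLimit (fun i => AddMonoidAlgebra k (M i))
        (fun i j h => mapDomainAlgHom k k (t i j h)) :=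
    { toFun d := DirectLimit.lift t (fun i a => ⟦⟨i, single a 1⟩⟧)
        (fun i j h x => by
          rw [DirectLimit.eq_of_le _ j h]; simp) d.toAdd
      map_one' := by
        rw [toAdd_one, DirectLimit.zero_def 0, DirectLimit.lift_def, DirectLimit.one_def 0]; rfl
      map_mul' x y := by
        rw [toAdd_mul]
        induction x.toAdd, y.toAdd using DirectLimit.induction₂ with | _ i x y
        rw [DirectLimit.add_def]
        simp only [DirectLimit.lift_def]
        rw [DirectLimit.mul_def, single_mul_single, one_mul] }
  let of (i) : M i →+ DirectLimit M t :=
    { toFun a := ⟦⟨i, a⟩⟧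
      map_zero' := (DirectLimit.zero_def i).symm
      map_add' a b := (DirectLimit.add_def i a b).symm }
  have hof (i j h) : (of j).comp (t i j h) = of i := by
    ext a; exact (DirectLimit.eq_of_le ⟨i, a⟩ j h).symm
  -- `π` compares the direct limit of the algebras with the algebra of the direct limit; composed
  -- with the restriction of exponents along `f` it is the retraction.
  let π := DirectLimit.Algebra.lift (R := k) (fun i => AddMonoidAlgebra k (M i))
    (fun i j h => mapDomainAlgHom k k (t i j h)) (AddMonoidAlgebra k (DirectLimit M t))
    (fun i => mapDomainAlgHom k k (of i)) (fun i j h x => by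
      rw [← AlgHom.comp_apply, ← mapDomainAlgHom_comp, hof])
  let ι := lift k _ H (Ψ.comp f.toMultiplicative)
  have hπΨ (d) : π (Ψ (.ofAdd d)) = single d 1 := by
    induction d using DirectLimit.induction with | _ i a
    exact mapDomain_single
  have hπι : π.comp ι = mapDomainAlgHom k k f := by
    ext h
    simp [ι, hπΨ]
  have hπι' (y) : π (ι y) = mapDomain f y := congr($hπι y)
  refine ⟨ι, RingHom.isDirectSummand_of_retraction _
    ((comapDomainAddMonoidHom f hf).comp π.toRingHom.toAddMonoidHom) (fun y => ?_) fun y a => ?_⟩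
  · change comapDomain f hf (π (ι y)) = y
    rw [hπι']
    ext h
    simp [Finsupp.mapDomain_apply hf]
  · change comapDomain f hf (π (ι y * a)) = y * comapDomain f hf (π a)
    rw [map_mul, hπι', comapDomain_mapDomain_mul f hf hpure]

end AddMonoidAlgebra

/-! ### Coordinates with respect to a family of functionals -/

/-- The vector `a` of natural numbers is the coordinate vector of `x` with respect to the
functionals `u`. Such a vector exists only if all the functionals are nonnegative at `x`. -/
def IsCoord {G σ : Type*} [AddCommGroup G] (u : σ → G →+ ℤ) (a : σ →₀ ℕ) (x : G) : Prop :=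
  ∀ l, (a l : ℤ) = u l x

namespace IsCoord

variable {G σ τ : Type*} [AddCommGroup G] {u : σ → G →+ ℤ} {a b : σ →₀ ℕ} {x y : G}

theorem unique (ha : IsCoord u a x) (hb : IsCoord u b x) : a = b := by
  ext l
  have := (ha l).trans (hb l).symm
  exact_mod_cast this

theorem zero : IsCoord u 0 0 := fun l => by simp

theorem add (ha : IsCoord u a x) (hb : IsCoord u b y) : IsCoord u (a + b) (x + y) := fun l => by
  simp [ha l, hb l]

theorem of_add (ha : IsCoord u a x) (hb : IsCoord u (a + b) y) : IsCoord u b (y - x) := fun l => by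
  have := hb l
  rw [map_sub, ← ha l, ← this]
  simp

theorem exists_of_nonneg [Finite σ] (h : ∀ l, 0 ≤ u l x) : ∃ a, IsCoord u a x :=
  ⟨Finsupp.equivFunOnFinite.symm fun l => (u l x).toNat, fun l => by simp [h l]⟩

theorem nonneg_of_mem_closure (ha : IsCoord u a x) {f : G →+ ℤ}
    (hf : f ∈ AddSubmonoid.closure (Set.range u)) : 0 ≤ f x := by
  induction hf using AddSubmonoid.closure_induction with
  | mem f hf => obtain ⟨l, rfl⟩ := hf; rw [← ha l]; exact Int.natCast_nonneg _
  | zero => exact le_rfl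
  | add f g _ _ hf hg => exact add_nonneg hf hg

/-- If every `v m` is a combination of the `u l` with natural coefficients, then these coefficients
define an additive map carrying `u`-coordinates to `v`-coordinates. -/
theorem exists_transition [Finite τ] {v : τ → G →+ ℤ}
    (h : ∀ m, v m ∈ AddSubmonoid.closure (Set.range u)) :
    ∃ T : (σ →₀ ℕ) →+ (τ →₀ ℕ), ∀ a x, IsCoord u a x → IsCoord v (T a) x := by
  choose c hc using fun m => AddSubmonoid.mem_closure_range_iff.1 (h m)
  refine ⟨{ toFun a := Finsupp.equivFunOnFinite.symm fun m => (c m).sum fun l k => k * a l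
            map_zero' := by ext; simp
            map_add' a b := by ext; simp [mul_add, Finsupp.sum_add] }, fun a x ha m => ?_⟩
  simp [hc m, Finsupp.sum, ha _]

end IsCoord

/-! ### Direct systems indexed by the natural numbers -/

section NatSystem

variable {M : ℕ → Type*} [∀ i, AddCommMonoid (M i)] (T : ∀ i, M i →+ M (i + 1))

/-- The transition maps `M i → M j` obtained by composing the maps `T i : M i → M (i + 1)`. -/
def AddMonoidHom.natSystem (i j : ℕ) (h : i ≤ j) : M i →+ M j :=
  Nat.leRec (motive := fun j _ => M i →+ M j) (.id _) (fun j _ f => (T j).comp f) h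

theorem AddMonoidHom.natSystem_self (i : ℕ) : natSystem T i i le_rfl = .id _ :=
  Nat.leRec_self _ _

theorem AddMonoidHom.natSystem_succ (i j : ℕ) (h : i ≤ j) :
    natSystem T i (j + 1) (h.trans j.le_succ) = (T j).comp (natSystem T i j h) :=
  Nat.leRec_succ _ _ _

theorem AddMonoidHom.directedSystem_natSystem : DirectedSystem M (natSystem T · · ·) where
  map_self i x := by rw [natSystem_self]; rfl
  map_map l j i hij hjl x := by
    induction l, hjl using Nat.le_induction with
    | base => rw [natSystem_self]; rfl
    | succ l hjl ih =>
      rw [natSystem_succ T j l hjl, natSystem_succ T i l (hij.trans hjl)]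
      exact congrArg (T l) ih

end NatSystem

/-! ### Approximation of a normal semigroup by free monoids -/

/-- A positive normal subsemigroup of `ℤ ^ n` embeds into a direct limit of free commutative monoids
of finite rank, in such a way that every difference of its elements which lies in the limit lies in
the subsemigroup. -/
theorem exists_pure_directLimit {n : ℕ} (H : AddSubmonoid (Fin n → ℤ))
    (hpos : H.IsPositive) (hnormal : H.IsNormalSemigroup) :
    ∃ (s : ℕ → ℕ) (t : ∀ i j, i ≤ j → (Fin (s i) →₀ ℕ) →+ (Fin (s j) →₀ ℕ))
      (_ : DirectedSystem (fun i => Fin (s i) →₀ ℕ) (t · · ·))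
      (f : H →+ DirectLimit (fun i => Fin (s i) →₀ ℕ) t), Function.Injective f ∧
      ∀ h h' d, f h + d = f h' → d ∈ Set.range f := by
  classical
  obtain ⟨g, hg⟩ := exists_surjective_nat H
  let S (i : ℕ) : Finset (Fin n → ℤ) := (Finset.range i).image fun j => (g j : Fin n → ℤ)
  have hSmono {i j : ℕ} (h : i ≤ j) : (S i : Set (Fin n → ℤ)) ⊆ S j := by
    exact_mod_cast Finset.image_subset_image (Finset.range_mono h)
  have hSH (i : ℕ) : AddSubmonoid.closure (S i : Set (Fin n → ℤ)) ≤ H := by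
    rw [AddSubmonoid.closure_le]
    intro x hx
    obtain ⟨j, -, rfl⟩ := Finset.mem_image.1 hx
    exact (g j).2
  have hHS (x : H) : ∃ i, ∀ j, i ≤ j → (x : Fin n → ℤ) ∈ S j := by
    obtain ⟨i, rfl⟩ := hg x
    exact ⟨i + 1, fun j hj => Finset.mem_image.2 ⟨i, Finset.mem_range.2 hj, rfl⟩⟩
  choose s u hu using fun i => exists_closure_range_eq_dualMonoid (S i)
  -- The dual monoids decrease with `i`, so the generators at level `i + 1` are natural combinations
  -- of those at level `i`.
  choose T hT using fun i => IsCoord.exists_transition (u := u i) (v := u (i + 1)) fun m => by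
    rw [hu]
    refine dualMonoid_anti (hSmono i.le_succ) ?_
    rw [← hu]
    exact AddSubmonoid.subset_closure ⟨m, rfl⟩
  let t := AddMonoidHom.natSystem (M := fun i => Fin (s i) →₀ ℕ) T
  have ht : DirectedSystem (fun i => Fin (s i) →₀ ℕ) (t · · ·) :=
    AddMonoidHom.directedSystem_natSystem T
  have htc {i j : ℕ} (h : i ≤ j) {a x} (ha : IsCoord (u i) a x) : IsCoord (u j) (t i j h a) x := by
    induction j, h using Nat.le_induction with
    | base => rw [DirectedSystem.map_self' t]; exact ha
    | succ j h ih =>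
      have := hT j _ _ ih
      rwa [← AddMonoidHom.comp_apply, ← AddMonoidHom.natSystem_succ] at this
  have hcoord {i : ℕ} {x : Fin n → ℤ} (hx : x ∈ S i) : ∃ a, IsCoord (u i) a x := by
    refine IsCoord.exists_of_nonneg fun l => ?_
    have : u i l ∈ dualMonoid (S i : Set (Fin n → ℤ)) := by
      rw [← hu]
      exact AddSubmonoid.subset_closure ⟨l, rfl⟩
    exact this x hx
  -- This is where normality enters: by Farkas' lemma, a difference with nonnegative coordinates at
  -- some level has a positive multiple in `H`.
  have hmem {i : ℕ} {a : Fin (s i) →₀ ℕ} {x y : H} (ha : IsCoord (u i) a (x - y : Fin n → ℤ)) :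
      (x - y : Fin n → ℤ) ∈ H := by
    obtain ⟨m, hm, hmx⟩ := exists_nsmul_mem_closure (S i) (x - y : Fin n → ℤ) fun f hf =>
      ha.nonneg_of_mem_closure (by rw [hu]; exact hf)
    exact hnormal x x.2 y y.2 m hm (hSH i hmx)
  have hclass {i j : ℕ} {a b x} (ha : IsCoord (u i) a x) (hb : IsCoord (u j) b x) :
      (⟦⟨i, a⟩⟧ : DirectLimit (fun i => Fin (s i) →₀ ℕ) t) = ⟦⟨j, b⟩⟧ :=
    Quotient.sound ⟨max i j, le_max_left _ _, le_max_right _ _, (htc _ ha).unique (htc _ hb)⟩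
  have hstep {i j : ℕ} (h : i ≤ j) (a : Fin (s i) →₀ ℕ) :
      (⟦⟨i, a⟩⟧ : DirectLimit (fun i => Fin (s i) →₀ ℕ) t) = ⟦⟨j, t i j h a⟩⟧ :=
    DirectLimit.eq_of_le (f := t) ⟨i, a⟩ j h
  have hex (x : H) : ∃ d : DirectLimit (fun i => Fin (s i) →₀ ℕ) t,
      ∀ i a, IsCoord (u i) a (x : Fin n → ℤ) → d = ⟦⟨i, a⟩⟧ := by
    obtain ⟨i, hi⟩ := hHS x
    obtain ⟨a, ha⟩ := hcoord (hi i le_rfl)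
    exact ⟨⟦⟨i, a⟩⟧, fun j b hb => hclass ha hb⟩
  choose f hf using hex
  have hlevel (x y : H) (i : ℕ) : ∃ j, i ≤ j ∧ ∃ a b, IsCoord (u j) a (x : Fin n → ℤ) ∧
      IsCoord (u j) b (y : Fin n → ℤ) := by
    obtain ⟨p, hp⟩ := hHS x
    obtain ⟨q, hq⟩ := hHS y
    obtain ⟨a, ha⟩ := hcoord (hp (max i (max p q)) (by omega))
    obtain ⟨b, hb⟩ := hcoord (hq (max i (max p q)) (by omega))
    exact ⟨_, le_max_left _ _, a, b, ha, hb⟩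
  let F : H →+ DirectLimit (fun i => Fin (s i) →₀ ℕ) t :=
    { toFun := f
      map_zero' := by rw [hf 0 0 0 IsCoord.zero, DirectLimit.zero_def 0]
      map_add' x y := by
        obtain ⟨j, -, a, b, ha, hb⟩ := hlevel x y 0
        rw [hf x j a ha, hf y j b hb, hf (x + y) j (a + b) (ha.add hb), DirectLimit.add_def] }
  -- If `F x + d = F y`, then `d` is represented by the coordinates of `y - x` at some level.
  have hdiff (x y : H) (d) (h : F x + d = F y) :
      ∃ i a, d = ⟦⟨i, a⟩⟧ ∧ IsCoord (u i) a (y - x : Fin n → ℤ) := by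
    induction d using DirectLimit.induction with | _ i c
    obtain ⟨j, hij, a, b, ha, hb⟩ := hlevel x y i
    change f x + _ = f y at h
    rw [hf x j a ha, hf y j b hb, hstep hij, DirectLimit.add_def] at h
    obtain ⟨l, hjl, hjl', hl⟩ := Quotient.exact h
    refine ⟨l, t j l hjl (t i j hij c), ?_, (htc hjl ha).of_add ?_⟩
    · rw [hstep hij, hstep hjl]
    · rw [← map_add]
      exact hl ▸ htc hjl' hb
  refine ⟨s, t, ht, F, fun x y hxy => ?_, fun x y d hd => ?_⟩
  · obtain ⟨i, a, -, ha⟩ := hdiff x y 0 (by rw [hxy, add_zero])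
    obtain ⟨j, b, -, hb⟩ := hdiff y x 0 (by rw [hxy, add_zero])
    have := hpos _ (hmem hb) (by rw [neg_sub]; exact hmem ha)
    exact Subtype.ext (sub_eq_zero.1 this)
  · obtain ⟨i, a, rfl, ha⟩ := hdiff x y d hd
    exact ⟨⟨_, hmem ha⟩, hf _ i a ha⟩

theorem mainTheorem3 {k : Type*} [Field k] (n : ℕ) (H : AddSubmonoid (Fin n → ℤ))
    (hpos : H.IsPositive) (hnormal : H.IsNormalSemigroup) :
    ∃ (s : ℕ → ℕ)
      (φ : ∀ i j : ℕ, i ≤ j → MvPolynomial (Fin (s i)) k →ₐ[k] MvPolynomial (Fin (s j)) k)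
      (_ : DirectedSystem (fun i => MvPolynomial (Fin (s i)) k) (φ · · ·)),
      (∀ i, IsNoetherianRing (MvPolynomial (Fin (s i)) k)) ∧
      (∀ (i j : ℕ) (h : i ≤ j), MvPolynomial.IsToric (φ i j h)) ∧
      ∃ ι : AddMonoidAlgebra k H →ₐ[k]
          DirectLimit (fun i => MvPolynomial (Fin (s i)) k) φ,
        RingHom.IsDirectSummand (ι : AddMonoidAlgebra k H →+*
          DirectLimit (fun i => MvPolynomial (Fin (s i)) k) φ) := by
  obtain ⟨s, t, ht, f, hf, hpure⟩ := exists_pure_directLimit H hpos hnormal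
  have hsys := AddMonoidAlgebra.directedSystem_mapDomainAlgHom (k := k) t
  exact ⟨s, fun i j h => AddMonoidAlgebra.mapDomainAlgHom k k (t i j h), hsys,
    fun i => inferInstance, fun i j h a => ⟨t i j h a, AddMonoidAlgebra.mapDomain_single⟩,
    AddMonoidAlgebra.exists_isDirectSummand_directLimit t f hf hpure⟩
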